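/- Let $0<m<n$ and let $f:\mathbb R^n\to\mathbb R^m$ be a smooth ($C^\infty$) function whose $m\times n$ Jacobian matrix $J(x)$ has full rank $m$ for every $x\in\mathbb R^n$. Let $H(x)$ be the second derivative of $f$ at $x$ (a symmetric bilinear map $\mathbb R^n\times\mathbb R^n\to\mathbb R^m$), and write $H(x)[w,\cdot]$ for the $m\times n$ matrix of the linear map $z\mapsto H(x)[w,z]$. Put $$J(x)^+=J(x)^\top\big(J(x)J(x)^\top\big)^{-1},\qquad N(x)=J(x)^+J(x),\qquad T(x)=I-N(x),$$ $$N'_\perp(x)[w]=J(x)^+\,H(x)[w,\cdot]\,T(x),\qquad N'_\|(x)[w]=\big(N'_\perp(x)[w]\big)^\top .$$ Consider the system of ordinary differential equations in $\mathbb R^n\times\mathbb R^n$ $$\frac{dx}{dt}=T(x)v,\qquad \frac{dv}{dt}=\Big(N'_\|(x)\big[(T(x)-N(x))v\big]-N'_\perp(x)\big[(T(x)-N(x))v\big]\Big)v .$$ **Theorem.** The system has the following properties. 1. It preserves volume in $\mathbb R^n\times\mathbb R^n$: its right-hand side is a differentiable vector field with divergence zero everywhere; the system has a flow $(\Phi_t)_{t\in\mathbb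 R}$ (for every $z$, $t\mapsto\Phi_t(z)$ is a solution defined for all $t\in\mathbb R$, with $\Phi_0(z)=z$); and for every such flow each map $\Phi_t$ preserves Lebesgue measure on $\mathbb R^n\times\mathbb R^n$. 2. It is time-reversible, i.e. it is invariant under changing $t$ into $-t$ and $v$ into $-v$: for every interval $I\subseteq\mathbb R$, $(x(t),v(t))$ is a solution on $I$ if and only if $(x(-t),-v(-t))$ is a solution on $-I$. 3. It conserves the Euclidean length of $v$: for every solution $(x(t),v(t))$ on an interval $I$, $\frac{d}{dt}\|v(t)\|^2=0$ on $I$, and $\|v(t)\|=\|v(s)\|$ for all $s,t\in I$. 4. Solutions remain on level sets of $f$: for every solution $(x(t),v(t))$ on an interval $I$, $\frac{d}{dt}f(x(t))=0$ on $I$, and $x(t)\in\mathcal M(f(x(s)))$ for all $s,t\in I$, where $\mathcal M(\eta)=\{y\in\mathbb R^n:f(y)=\eta\}$. -/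

import Mathlib

open scoped ContDiff

noncomputable section

namespace Hug

/-- `ℝⁿ` with its Euclidean inner product, norm and Lebesgue measure. -/
abbrev E (n : ℕ) : Type := EuclideanSpace ℝ (Fin n)

variable {n m : ℕ}

/-- The level set `M(η) = {y : f y = η}`. -/
def levelSet (f : E n → E m) (η : E m) : Set (E n) := {y | f y = η}

/-- The Jacobian `J(x)` of `f`, as a linear map `ℝⁿ → ℝᵐ`. Transposes of matrices are adjoints of
linear maps throughout. -/
def J (f : E n → E m) (x : E n) : E n →L[ℝ] E m := fderiv ℝ f x

/-- The second derivative `H(x)[w, ·]` of `f`, as a linear map `ℝⁿ → ℝᵐ` depending linearly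
on `w`. -/
def H (f : E n → E m) (x : E n) : E n →L[ℝ] E n →L[ℝ] E m := fderiv ℝ (fderiv ℝ f) x

/-- The Moore-Penrose inverse `J⁺ = Jᵀ (J Jᵀ)⁻¹` (for `J(x)` of full rank `m`, the operator
`J Jᵀ` is invertible and `Ring.inverse` is its inverse). -/
def Jplus (f : E n → E m) (x : E n) : E m →L[ℝ] E n :=
  ContinuousLinearMap.adjoint (J f x) ∘L
    Ring.inverse (J f x ∘L ContinuousLinearMap.adjoint (J f x))

/-- The projection `N(x) = J⁺ J` onto the normal space. -/
def N (f : E n → E m) (x : E n) : E n →L[ℝ] E n := Jplus f x ∘L J f x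

/-- The complementary projection `T(x) = I - N(x)` onto the tangent space. -/
def T (f : E n → E m) (x : E n) : E n →L[ℝ] E n := ContinuousLinearMap.id ℝ (E n) - N f x

/-- `N'_⊥(x)[w] = J(x)⁺ H(x)[w, ·] T(x)`. -/
def Nperp (f : E n → E m) (x w : E n) : E n →L[ℝ] E n := Jplus f x ∘L H f x w ∘L T f x

/-- `N'_∥(x)[w] = (N'_⊥(x)[w])ᵀ`. -/
def Npar (f : E n → E m) (x w : E n) : E n →L[ℝ] E n :=
  ContinuousLinearMap.adjoint (Nperp f x w)

/-- The right-hand side `(x, v) ↦ (T(x) v, (N'_∥(x)[(T - N)v] - N'_⊥(x)[(T - N)v]) v)` of the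
system of ODEs. -/
def field (f : E n → E m) (z : E n × E n) : E n × E n :=
  (T f z.1 z.2,
    (Npar f z.1 ((T f z.1 - N f z.1) z.2) - Nperp f z.1 ((T f z.1 - N f z.1) z.2)) z.2)

/-- `t ↦ (x t, v t)` is a solution of the system on `I ⊆ ℝ` (one-sided derivatives at those end
points of the interval `I` that belong to `I`). -/
def IsSolutionOn (f : E n → E m) (I : Set ℝ) (x v : ℝ → E n) : Prop :=
  ∀ t ∈ I, HasDerivWithinAt x (field f (x t, v t)).1 I t ∧
    HasDerivWithinAt v (field f (x t, v t)).2 I t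

/-- The divergence of a vector field at `z`: the trace of its derivative. -/
def divergence (F : E n × E n → E n × E n) (z : E n × E n) : ℝ :=
  LinearMap.trace ℝ (E n × E n) (fderiv ℝ F z : E n × E n →ₗ[ℝ] E n × E n)

/-- `Φ t z` is the value at time `t` of a solution, defined for all times, of the system with
value `z` at time `0`. -/
def IsFlow (f : E n → E m) (Φ : ℝ → E n × E n → E n × E n) : Prop :=
  ∀ z, Φ 0 z = z ∧ IsSolutionOn f Set.univ (fun t => (Φ t z).1) (fun t => (Φ t z).2)

end Hug

end

/-! Since `J` has full rank, `N` and `T` are complementary orthogonal projections with `J T = 0`, so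
`f` is constant along solutions. The matrix multiplying `v` in the second equation has the form `Aᵀ
- A`, so it is skew and `‖v‖` is constant. The `x` equation is odd in `v` and the `v` equation is
even, which gives reversibility.

Differentiating `J N = J`, `N N = N` and `Nᵀ = N` gives `N' = N'_⊥ + N'_∥` (`fderiv_N_apply`). Put
`P w = N'_⊥[w] v` and `Q w = N'_∥[w] v`. Up to a skew term of trace zero, the divergence is the
trace of `-(P + Q) + (Q - P)(T - N) = -2 P T - 2 Q N`. It vanishes because `P` takes values in the
range of `N` and `Q` in the range of `T` (`divergence_field`).

Solutions are global because `‖T v‖ ≤ ‖v‖` and `‖v‖` is constant, so `x` moves at bounded speed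
(`norm_integralCurve_le`).

Liouville's theorem (`measurePreserving_flow`) is obtained without differentiating the flow in its
initial value. An Euler step of length `h` has Jacobian determinant `1 + o(h)`, so many short steps
lose almost no volume, and they carry a compact set into a thin neighbourhood of its image under the
flow. Hence the flow does not decrease volume; the same for reversed time gives equality. -/

open Set Filter Metric MeasureTheory Topology NNReal

/-! ### Uniqueness and global existence of integral curves. -/

section ODE

variable {V : Type*} [NormedAddCommGroup V] [NormedSpace ℝ V]

/-- A `C¹` map on a finite-dimensional space is Lipschitz on every ball. -/
theorem ContDiff.exists_lipschitzOnWith_closedBall [FiniteDimensional ℝ V] {F : V → V}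
    (hF : ContDiff ℝ 1 F) (R : ℝ) : ∃ K : ℝ≥0, LipschitzOnWith K F (closedBall 0 R) := by
  have hc : Continuous fun x => ‖fderiv ℝ F x‖₊ :=
    (hF.continuous_fderiv one_ne_zero).nnnorm
  have := FiniteDimensional.proper ℝ V
  obtain ⟨K, hK⟩ := (isCompact_closedBall (0 : V) R).bddAbove_image hc.continuousOn
  exact ⟨K, (convex_closedBall 0 R).lipschitzOnWith_of_nnnorm_fderiv_le
    (fun x _ => (hF.differentiable one_ne_zero) x) fun x hx => hK ⟨x, hx, rfl⟩⟩

/-- Two integral curves of a `C¹` field on an open interval around `0` agree if they agree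
at `0`. -/
theorem ContDiff.integralCurve_eqOn_Ioo [FiniteDimensional ℝ V] {F : V → V}
    (hF : ContDiff ℝ 1 F) {a : ℝ} {γ γ' : ℝ → V}
    (hγ : ∀ t ∈ Ioo (-a) a, HasDerivAt γ (F (γ t)) t)
    (hγ' : ∀ t ∈ Ioo (-a) a, HasDerivAt γ' (F (γ' t)) t) (h0 : γ 0 = γ' 0) :
    EqOn γ γ' (Ioo (-a) a) := by
  intro t ht
  -- On the closed interval `[-b, b]` both curves are bounded, so a single Lipschitz constant
  -- serves.
  obtain ⟨b, htb, hba⟩ := exists_between (abs_lt.2 ht)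
  have hsub : Icc (-b) b ⊆ Ioo (-a) a := fun s hs => ⟨by linarith [hs.1], by linarith [hs.2]⟩
  have hc : ContinuousOn γ (Icc (-b) b) := HasDerivAt.continuousOn fun s hs => hγ s (hsub hs)
  have hc' : ContinuousOn γ' (Icc (-b) b) := HasDerivAt.continuousOn fun s hs => hγ' s (hsub hs)
  obtain ⟨R, hR⟩ := ((isCompact_Icc.image_of_continuousOn hc).union
    (isCompact_Icc.image_of_continuousOn hc')).isBounded.subset_closedBall 0
  obtain ⟨K, hK⟩ := hF.exists_lipschitzOnWith_closedBall R
  refine ODE_solution_unique_of_mem_Icc (v := fun _ => F) (s := fun _ => closedBall 0 R)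
    (t₀ := 0) (fun _ _ => hK) ?_ hc (fun s hs => hγ s (hsub (Ioo_subset_Icc_self hs)))
    (fun s hs => hR (Or.inl ⟨s, Ioo_subset_Icc_self hs, rfl⟩)) hc'
    (fun s hs => hγ' s (hsub (Ioo_subset_Icc_self hs)))
    (fun s hs => hR (Or.inr ⟨s, Ioo_subset_Icc_self hs, rfl⟩)) h0 (abs_le.1 htb.le)
  have := (abs_nonneg t).trans_lt htb
  exact ⟨by linarith, this⟩

theorem ContDiff.integralCurve_eq [FiniteDimensional ℝ V] {F : V → V}
    (hF : ContDiff ℝ 1 F) {γ γ' : ℝ → V} (hγ : ∀ t, HasDerivAt γ (F (γ t)) t)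
    (hγ' : ∀ t, HasDerivAt γ' (F (γ' t)) t) (h0 : γ 0 = γ' 0) : γ = γ' := by
  ext t
  exact hF.integralCurve_eqOn_Ioo (fun t _ => hγ t) (fun t _ => hγ' t) h0
    (abs_lt.1 (lt_add_one |t|))

/-- A bounded Lipschitz field has integral curves on every interval around `0`. -/
theorem LipschitzWith.exists_integralCurve_Ioo [CompleteSpace V] {G : V → V} {K M : ℝ≥0}
    (hG : LipschitzWith K G) (hM : ∀ x, ‖G x‖ ≤ M) (z : V) {a : ℝ} (ha : 0 ≤ a) :
    ∃ γ : ℝ → V, γ 0 = z ∧ ∀ t ∈ Ioo (-a) a, HasDerivAt γ (G (γ t)) t := by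
  have h0 : (0 : ℝ) ∈ Icc (-a) a := ⟨by linarith, ha⟩
  -- A curve of speed at most `M` stays within `M * a` of `z` up to time `a`.
  have hpl : IsPicardLindelof (fun _ => G) (⟨0, h0⟩ : Icc (-a) a) z (M * a.toNNReal) 0 M K :=
    .of_time_independent (fun x _ => hM x) hG.lipschitzOnWith (by simp [ha])
  obtain ⟨γ, h, hγ⟩ := hpl.exists_eq_forall_mem_Icc_hasDerivWithinAt₀
  exact ⟨γ, h, fun t ht => (hγ t (Ioo_subset_Icc_self ht)).hasDerivAt (Icc_mem_nhds ht.1 ht.2)⟩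

/-- A `C¹` field has global integral curves if the integral curves of all fields `χ • F` with
`χ : V → [0, 1]` satisfy a common a priori bound. -/
theorem ContDiff.exists_integralCurve_of_bound [FiniteDimensional ℝ V] {F : V → V}
    (hF : ContDiff ℝ 1 F) (z : V)
    (hb : ∀ a : ℝ, ∃ R : ℝ, ∀ (χ : V → ℝ) (γ : ℝ → V), (∀ y, χ y ∈ Icc (0 : ℝ) 1) → γ 0 = z →
      (∀ t ∈ Ioo (-a) a, HasDerivAt γ (χ (γ t) • F (γ t)) t) → ∀ t ∈ Ioo (-a) a, ‖γ t‖ ≤ R) :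
    ∃ γ : ℝ → V, γ 0 = z ∧ ∀ t, HasDerivAt γ (F (γ t)) t := by
  have := FiniteDimensional.proper ℝ V
  have := FiniteDimensional.complete ℝ V
  have key : ∀ a : ℝ, 0 ≤ a → ∃ γ : ℝ → V, γ 0 = z ∧
      ∀ t ∈ Ioo (-a) a, HasDerivAt γ (F (γ t)) t := by
    intro a ha
    obtain ⟨R, hR⟩ := hb a
    -- The cut-off is `1` on a ball containing every curve bounded by `R`, so the curve of `χ • F`
    -- is a curve of `F`.
    let χ : ContDiffBump (0 : V) := ⟨|R| + 1, |R| + 2, by positivity, by linarith⟩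
    have hG : ContDiff ℝ 1 fun y => χ y • F y := χ.contDiff.smul hF
    have hGc : HasCompactSupport fun y => χ y • F y := χ.hasCompactSupport.smul_right
    obtain ⟨K, hK⟩ := hG.lipschitzWith_of_hasCompactSupport hGc one_ne_zero
    obtain ⟨M, hM⟩ := hGc.exists_bound_of_continuous hG.continuous
    obtain ⟨γ, h0, hγ⟩ := hK.exists_integralCurve_Ioo (M := M.toNNReal)
      (fun x => (hM x).trans (Real.le_coe_toNNReal M)) z ha
    refine ⟨γ, h0, fun t ht => ?_⟩
    have h1 : χ (γ t) = 1 := χ.one_of_mem_closedBall <| by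
      have := hR χ γ (fun y => ⟨χ.nonneg, χ.le_one⟩) h0 hγ t ht
      simp only [mem_closedBall, dist_zero_right, χ]
      linarith [le_abs_self R]
    simpa [h1] using hγ t ht
  choose! γ h0 hγ using key
  -- The interval depends on `t`; by uniqueness the chosen curves agree on overlaps, so the diagonal
  -- is locally one of them.
  refine ⟨fun t => γ (|t| + 1) t, h0 _ (by positivity), fun t => ?_⟩
  have hmem : Ioo (-(|t| + 1)) (|t| + 1) ∈ 𝓝 t := by
    have := abs_lt.1 (lt_add_one |t|)
    exact Ioo_mem_nhds this.1 this.2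
  refine (hγ (|t| + 1) (by positivity) t (mem_of_mem_nhds hmem)).congr_of_eventuallyEq ?_
  filter_upwards [hmem] with s hs
  have hc : 0 < min (|s| + 1) (|t| + 1) := by positivity
  refine hF.integralCurve_eqOn_Ioo (a := min (|s| + 1) (|t| + 1))
    (fun r hr => hγ _ (by positivity) r ?_) (fun r hr => hγ _ (by positivity) r ?_)
    ((h0 _ (by positivity)).trans (h0 _ (by positivity)).symm) ?_
  · exact ⟨by linarith [hr.1, min_le_left (|s| + 1) (|t| + 1)],
      hr.2.trans_le (min_le_left _ _)⟩
  · exact ⟨by linarith [hr.1, min_le_right (|s| + 1) (|t| + 1)],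
      hr.2.trans_le (min_le_right _ _)⟩
  · exact abs_lt.1 (lt_min (lt_add_one _) (abs_lt.2 hs))

end ODE

/-! ### The determinant near the identity. -/

section Det

variable {V : Type*} [NormedAddCommGroup V] [NormedSpace ℝ V]

theorem ContinuousLinearMap.differentiable_det [FiniteDimensional ℝ V] :
    Differentiable ℝ (ContinuousLinearMap.det : (V →L[ℝ] V) → ℝ) := by
  classical
  let b := Module.finBasis ℝ V
  have h : (ContinuousLinearMap.det : (V →L[ℝ] V) → ℝ) = fun A =>
      ∑ σ : Equiv.Perm (Fin (Module.finrank ℝ V)), (Equiv.Perm.sign σ : ℝ) *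
        ∏ i, LinearMap.toContinuousLinearMap (b.coord (σ i)) (A (b i)) := by
    ext A
    rw [ContinuousLinearMap.det, ← LinearMap.det_toMatrix b, Matrix.det_apply']
    simp [LinearMap.toMatrix_apply]
  rw [h]
  fun_prop

theorem LinearMap.hasDerivAt_det_one_add_smul [FiniteDimensional ℝ V] (A : V →ₗ[ℝ] V) :
    HasDerivAt (fun r : ℝ => LinearMap.det (1 + r • A)) (LinearMap.trace ℝ V A) 0 := by
  classical
  let b := Module.finBasis ℝ V
  have h : (fun r : ℝ => LinearMap.det (1 + r • A)) = fun r : ℝ =>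
      ((1 : Polynomial ℝ) + Matrix.trace (LinearMap.toMatrix b b A) • Polynomial.X +
        (Matrix.det (1 + (Polynomial.X : Polynomial ℝ) •
          (LinearMap.toMatrix b b A).map Polynomial.C)).divX.divX * Polynomial.X ^ 2).eval r := by
    ext r
    rw [← LinearMap.det_toMatrix b, map_add, map_smul, LinearMap.toMatrix_one,
      Matrix.det_one_add_smul]
    simp
  rw [h, LinearMap.trace_eq_matrix_trace ℝ b]
  convert! Polynomial.hasDerivAt _ (0 : ℝ) using 1
  simp

/-- To first order, adding a traceless operator does not change the determinant `1` of the
identity. -/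
theorem ContinuousLinearMap.exists_le_abs_det_one_add_smul [FiniteDimensional ℝ V]
    (M : ℝ) {ε : ℝ} (hε : 0 < ε) :
    ∃ δ > 0, ∀ h ∈ Icc (0 : ℝ) δ, ∀ A : V →L[ℝ] V, ‖A‖ ≤ M →
      LinearMap.trace ℝ V (A : V →ₗ[ℝ] V) = 0 → 1 - ε * h ≤ |(1 + h • A).det| := by
  set D := fderiv ℝ (ContinuousLinearMap.det : (V →L[ℝ] V) → ℝ) 1
  have hD : HasFDerivAt (ContinuousLinearMap.det : (V →L[ℝ] V) → ℝ) D 1 :=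
    (ContinuousLinearMap.differentiable_det _).hasFDerivAt
  have htr : ∀ A : V →L[ℝ] V, D A = LinearMap.trace ℝ V (A : V →ₗ[ℝ] V) := by
    intro A
    have h1 : HasDerivAt (fun r : ℝ => (1 : V →L[ℝ] V) + r • A) A 0 := by
      simpa using ((hasDerivAt_id (0 : ℝ)).smul_const A).const_add (1 : V →L[ℝ] V)
    have h2 : HasFDerivAt (ContinuousLinearMap.det : (V →L[ℝ] V) → ℝ) D
        ((1 : V →L[ℝ] V) + (0 : ℝ) • A) := by simpa using hD
    have h3 := h2.comp_hasDerivAt (0 : ℝ) h1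
    exact h3.unique (LinearMap.hasDerivAt_det_one_add_smul (A : V →ₗ[ℝ] V))
  have hM : 0 < |M| + 1 := by positivity
  have ho := (hasFDerivAt_iff_isLittleO_nhds_zero.1 hD).def (div_pos hε hM)
  obtain ⟨δ, hδ, hball⟩ := Metric.eventually_nhds_iff.1 ho
  -- This makes `‖h • A‖ ≤ δ / 2 < δ`; the tolerance `ε / (|M| + 1)` then turns into an error of at
  -- most `ε * h`.
  refine ⟨δ / (2 * (|M| + 1)), by positivity, fun h hh A hA hA0 => ?_⟩
  have hAM : ‖A‖ ≤ |M| + 1 := by linarith [le_abs_self M]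
  have hn : ‖h • A‖ ≤ h * (|M| + 1) := by
    rw [norm_smul, Real.norm_of_nonneg hh.1]
    exact mul_le_mul_of_nonneg_left hAM hh.1
  have hlt : dist (h • A) 0 < δ := by
    rw [dist_zero_right]
    have h3 : h * (2 * (|M| + 1)) ≤ δ := (le_div_iff₀ (by positivity)).1 hh.2
    linarith
  have hb := hball hlt
  rw [map_smul, htr, hA0, smul_zero, sub_zero, Real.norm_eq_abs] at hb
  have hdet : ContinuousLinearMap.det (1 : V →L[ℝ] V) = 1 := by
    simp [ContinuousLinearMap.det]
  rw [hdet] at hb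
  have h4 : ε / (|M| + 1) * ‖h • A‖ ≤ ε * h := by
    calc _ ≤ ε / (|M| + 1) * (h * (|M| + 1)) := by gcongr
      _ = ε * h := by field_simp
  have := neg_le_of_abs_le hb
  linarith [le_abs_self (ContinuousLinearMap.det (1 + h • A))]

end Det

/-! ### Euler's method: error and volume. -/

section Euler

variable {V : Type*} [NormedAddCommGroup V] [NormedSpace ℝ V]

/-- One step of length `h` of Euler's method for the field `F`. -/
def eulerStep (F : V → V) (h : ℝ) (z : V) : V := z + h • F z

/-- The error of Euler's method. -/
theorem norm_eulerStep_iterate_sub_le {F : V → V} {γ : ℝ → V}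
    (hγ : ∀ t, HasDerivAt γ (F (γ t)) t) {L : ℝ≥0} {M ρ h : ℝ} (hh : 0 ≤ h)
    (hL : LipschitzOnWith L F (closedBall 0 (ρ + 1))) (hM : ∀ y ∈ closedBall 0 ρ, ‖F y‖ ≤ M)
    (hM0 : 0 ≤ M) {n : ℕ} (hρ : ∀ s ∈ Icc 0 (n * h), ‖γ s‖ ≤ ρ)
    (hsmall : h * M * ((1 + h * L) ^ n - 1) ≤ 1) {k : ℕ} (hk : k ≤ n) :
    ‖(eulerStep F h)^[k] (γ 0) - γ (k * h)‖ ≤ h * M * ((1 + h * L) ^ k - 1) := by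
  have h1 : (1 : ℝ) ≤ 1 + h * L := by
    have : 0 ≤ h * L := by positivity
    linarith
  induction k with
  | zero => simp
  | succ k ih =>
    have ih := ih (by omega)
    set y := (eulerStep F h)^[k] (γ 0)
    have hkn : ((k : ℝ) + 1) * h ≤ n * h := by
      gcongr
      exact_mod_cast hk
    have hk0 : 0 ≤ (k : ℝ) * h := by positivity
    have hmem : ∀ r ∈ Icc 0 h, ‖γ (k * h + r)‖ ≤ ρ := fun r hr =>
      hρ _ ⟨by linarith [hr.1], by linarith [hr.2]⟩
    have hsub : closedBall (0 : V) ρ ⊆ closedBall 0 (ρ + 1) :=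
      closedBall_subset_closedBall (by linarith)
    have hx : ‖γ (k * h)‖ ≤ ρ := by simpa using hmem 0 ⟨le_rfl, hh⟩
    have hpow : (1 + h * (L : ℝ)) ^ k ≤ (1 + h * L) ^ n := pow_le_pow_right₀ h1 (by omega)
    -- The smallness assumption keeps the iterates within distance `1` of the curve, where `F` is
    -- `L`-Lipschitz.
    have hyx : ‖y - γ (k * h)‖ ≤ 1 := ih.trans (le_trans (by gcongr) hsmall)
    have hy : y ∈ closedBall (0 : V) (ρ + 1) := by
      rw [mem_closedBall_zero_iff]
      calc ‖y‖ = ‖γ (k * h) + (y - γ (k * h))‖ := by congr 1; abel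
        _ ≤ _ := (norm_add_le _ _).trans (by linarith)
    -- displacement of the curve
    have hdisp : ∀ r ∈ Icc 0 h, ‖γ (k * h + r) - γ (k * h)‖ ≤ M * h := by
      intro r hr
      have := norm_image_sub_le_of_norm_deriv_le_segment' (f := fun r => γ (k * h + r))
        (f' := fun r => F (γ (k * h + r))) (a := 0) (b := h) (C := M)
        (fun s _ => ((hγ (k * h + s)).comp_const_add _ _).hasDerivWithinAt)
        (fun s hs => hM _ (mem_closedBall_zero_iff.2 (hmem s (Ico_subset_Icc_self hs)))) r hr
      simp only [add_zero, sub_zero] at this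
      exact this.trans (by gcongr; exact hr.2)
    -- The derivative of `γ (k * h + r) - r • F (γ (k * h))` in `r` is a difference of values of `F`
    -- at points at most `M * h` apart.
    have htrunc : ‖γ ((k + 1) * h) - γ (k * h) - h • F (γ (k * h))‖ ≤ L * (M * h) * h := by
      have := norm_image_sub_le_of_norm_deriv_le_segment'
        (f := fun r => γ (k * h + r) - r • F (γ (k * h)))
        (f' := fun r => F (γ (k * h + r)) - F (γ (k * h))) (a := 0) (b := h) (C := L * (M * h))
        (fun s _ => by
          simpa using (((hγ (k * h + s)).comp_const_add _ _).fun_sub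
            ((hasDerivAt_id s).smul_const (F (γ (k * h))))).hasDerivWithinAt)
        (fun s hs => (hL.norm_sub_le
          (hsub (mem_closedBall_zero_iff.2 (hmem s (Ico_subset_Icc_self hs))))
          (hsub (mem_closedBall_zero_iff.2 hx))).trans (by
            gcongr; exact hdisp s (Ico_subset_Icc_self hs))) h ⟨hh, le_rfl⟩
      simp only [add_zero, sub_zero, zero_smul] at this
      convert this using 2
      rw [add_mul, one_mul]
      abel
    have hF : ‖F y - F (γ (k * h))‖ ≤ L * ‖y - γ (k * h)‖ :=
      hL.norm_sub_le hy (hsub (mem_closedBall_zero_iff.2 hx))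
    rw [Function.iterate_succ_apply']
    push_cast
    have heq : eulerStep F h y - γ ((k + 1) * h) = (y - γ (k * h)) + h • (F y - F (γ (k * h)))
        - (γ ((k + 1) * h) - γ (k * h) - h • F (γ (k * h))) := by
      rw [eulerStep, smul_sub]; abel
    rw [heq]
    -- The error satisfies `e (k+1) ≤ (1 + h L) e k + L M h²`, which the claimed bound solves with
    -- equality.
    calc _ ≤ ‖y - γ (k * h)‖ + h * (L * ‖y - γ (k * h)‖) + L * (M * h) * h := by
          refine (norm_sub_le _ _).trans (add_le_add ((norm_add_le _ _).trans ?_) htrunc)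
          rw [norm_smul, Real.norm_of_nonneg hh]
          gcongr
      _ = (1 + h * L) * ‖y - γ (k * h)‖ + L * (M * h) * h := by ring
      _ ≤ (1 + h * L) * (h * M * ((1 + h * L) ^ k - 1)) + L * (M * h) * h := by gcongr
      _ = _ := by ring

variable [MeasurableSpace V] [BorelSpace V] (μ : Measure V)

/-- Short Euler steps for a divergence-free field almost do not decrease volume. -/
theorem exists_le_measure_eulerStep_image [FiniteDimensional ℝ V] [μ.IsAddHaarMeasure]
    {F : V → V} (hF : ContDiff ℝ 1 F)
    (hdiv : ∀ z, LinearMap.trace ℝ V (fderiv ℝ F z : V →ₗ[ℝ] V) = 0) (ρ : ℝ) {ε : ℝ}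
    (hε : 0 < ε) :
    ∃ δ > 0, ∀ h ∈ Icc (0 : ℝ) δ, ∀ A ⊆ closedBall 0 ρ, MeasurableSet A →
      ENNReal.ofReal (1 - ε * h) * μ A ≤ μ (eulerStep F h '' A) := by
  have := FiniteDimensional.proper ℝ V
  obtain ⟨K, hK⟩ := hF.exists_lipschitzOnWith_closedBall ρ
  obtain ⟨M, hM⟩ := (isCompact_closedBall (0 : V) ρ).exists_bound_of_continuousOn
    (hF.continuous_fderiv one_ne_zero).continuousOn
  obtain ⟨δ, hδ, hdet⟩ := ContinuousLinearMap.exists_le_abs_det_one_add_smul (V := V) M hε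
  -- The second bound gives `h * K < 1`, which makes the Euler step injective on `A`, as the change
  -- of variables requires.
  refine ⟨min δ (1 / (K + 1)), by positivity, fun h hh A hA hAm => ?_⟩
  have hinj : InjOn (eulerStep F h) A := by
    intro x hx y hy hxy
    have h1 : x - y = h • (F y - F x) := by
      rw [smul_sub, sub_eq_sub_iff_add_eq_add, add_comm (h • F y)]
      exact hxy
    have h2 : ‖x - y‖ ≤ h * (K * ‖x - y‖) := by
      conv_lhs => rw [h1, norm_smul, Real.norm_of_nonneg hh.1, norm_sub_rev]
      gcongr
      · exact hh.1
      · exact hK.norm_sub_le (hA hx) (hA hy)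
    have h3 : h * (K + 1) ≤ 1 :=
      (le_div_iff₀ (by positivity)).1 (hh.2.trans (min_le_right _ _))
    rw [← sub_eq_zero, ← norm_eq_zero]
    by_contra hne
    have hpos : 0 < ‖x - y‖ := lt_of_le_of_ne (norm_nonneg _) (Ne.symm hne)
    have h4 : 1 ≤ h * K := by
      by_contra hlt
      nlinarith
    have h5 : 0 < h := by
      rcases hh.1.eq_or_lt with h0 | h0
      · rw [← h0] at h4; linarith
      · exact h0
    linarith
  have hderiv : ∀ x ∈ A, HasFDerivWithinAt (eulerStep F h) (1 + h • fderiv ℝ F x) A x :=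
    fun x _ => ((hasFDerivAt_id x).add
      ((hF.differentiable one_ne_zero x).hasFDerivAt.const_smul h)).hasFDerivWithinAt
  rw [← lintegral_abs_det_fderiv_eq_addHaar_image μ hAm hderiv hinj,
    ← setLIntegral_const]
  refine setLIntegral_mono' hAm fun x hx => ENNReal.ofReal_le_ofReal ?_
  exact hdet h ⟨hh.1, hh.2.trans (min_le_left _ _)⟩ _ (hM x (hA hx)) (hdiv x)

theorem le_measure_eulerStep_iterate_image {F : V → V} (hF : Continuous F) {ρ ε h : ℝ}
    (hstep : ∀ A ⊆ closedBall 0 ρ, MeasurableSet A →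
      ENNReal.ofReal (1 - ε * h) * μ A ≤ μ (eulerStep F h '' A))
    {K : Set V} (hK : IsCompact K) {n : ℕ}
    (hmem : ∀ k < n, ∀ z ∈ K, (eulerStep F h)^[k] z ∈ closedBall 0 ρ) :
    ENNReal.ofReal (1 - ε * h) ^ n * μ K ≤ μ ((eulerStep F h)^[n] '' K) := by
  have hc : Continuous (eulerStep F h) := continuous_id.add (hF.const_smul h)
  induction n with
  | zero => simp
  | succ n ih =>
    rw [pow_succ', mul_assoc, Function.iterate_succ', image_comp]
    refine (mul_le_mul_right (ih fun k hk => hmem k (by omega)) _).trans (hstep _ ?_ ?_)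
    · rintro _ ⟨z, hz, rfl⟩
      exact hmem n (by omega) z hz
    · exact (hK.image (hc.iterate n)).measurableSet

end Euler

/-! ### Liouville's theorem. -/

section Liouville

variable {V : Type*} [NormedAddCommGroup V] [NormedSpace ℝ V] [FiniteDimensional ℝ V]

/-- By Grönwall's inequality, `Φ t` is Lipschitz on the ball with constant `exp (K * t)`. -/
theorem ContDiff.continuousOn_flow {F : V → V} (hF : ContDiff ℝ 1 F) {Φ : ℝ → V → V}
    (h0 : ∀ z, Φ 0 z = z) (hΦ : ∀ z t, HasDerivAt (fun s => Φ s z) (F (Φ t z)) t) {t R ρ : ℝ}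
    (ht : 0 ≤ t) (hρ : ∀ z ∈ closedBall 0 R, ∀ s ∈ Icc 0 t, ‖Φ s z‖ ≤ ρ) :
    ContinuousOn (Φ t) (closedBall 0 R) := by
  obtain ⟨K, hK⟩ := hF.exists_lipschitzOnWith_closedBall ρ
  refine LipschitzOnWith.continuousOn (K := (Real.exp (K * t)).toNNReal)
    (LipschitzOnWith.of_dist_le_mul fun x hx y hy => ?_)
  have hc : ∀ z, ContinuousOn (fun s => Φ s z) (Icc 0 t) :=
    fun z => HasDerivAt.continuousOn fun s _ => hΦ z s
  have := dist_le_of_trajectories_ODE_of_mem (v := fun _ => F) (s := fun _ => closedBall 0 ρ)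
    (K := K) (δ := Dist.dist x y) (fun _ _ => hK) (hc x) (fun s _ => (hΦ x s).hasDerivWithinAt)
    (fun s hs => mem_closedBall_zero_iff.2 (hρ x hx s (Ico_subset_Icc_self hs))) (hc y)
    (fun s _ => (hΦ y s).hasDerivWithinAt)
    (fun s hs => mem_closedBall_zero_iff.2 (hρ y hy s (Ico_subset_Icc_self hs)))
    (by rw [h0, h0]) t ⟨ht, le_rfl⟩
  rw [sub_zero, mul_comm] at this
  rwa [Real.coe_toNNReal _ (Real.exp_nonneg _)]

variable [MeasurableSpace V] [BorelSpace V] (μ : Measure V) [μ.IsAddHaarMeasure]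

/-- The flow of a divergence-free field does not decrease the volume of compact sets. -/
theorem le_measure_flow_image {F : V → V} (hF : ContDiff ℝ 1 F)
    (hdiv : ∀ z, LinearMap.trace ℝ V (fderiv ℝ F z : V →ₗ[ℝ] V) = 0) {Φ : ℝ → V → V}
    (h0 : ∀ z, Φ 0 z = z) (hΦ : ∀ z t, HasDerivAt (fun s => Φ s z) (F (Φ t z)) t) {t R ρ : ℝ}
    (ht : 0 ≤ t) (hρ : ∀ z ∈ closedBall 0 R, ∀ s ∈ Icc 0 t, ‖Φ s z‖ ≤ ρ) {K : Set V}
    (hK : IsCompact K) (hKR : K ⊆ closedBall 0 R) : μ K ≤ μ (Φ t '' K) := by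
  have := FiniteDimensional.proper ℝ V
  obtain ⟨L, hL⟩ := hF.exists_lipschitzOnWith_closedBall (ρ + 1)
  obtain ⟨M, hM⟩ := (isCompact_closedBall (0 : V) ρ).exists_bound_of_continuousOn
    hF.continuous.continuousOn
  have hM' : ∀ y ∈ closedBall (0 : V) ρ, ‖F y‖ ≤ |M| := fun y hy => (hM y hy).trans (le_abs_self M)
  have himage : IsCompact (Φ t '' K) :=
    hK.image_of_continuousOn ((hF.continuousOn_flow h0 hΦ ht hρ).mono hKR)
  set C := |M| * Real.exp (L * t)
  have hC : 0 ≤ C := by positivity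
  have hstep_lim : Tendsto (fun n : ℕ => t / ((n : ℝ) + 1)) atTop (𝓝 0) := by
    simpa [div_eq_mul_inv] using (tendsto_one_div_add_atTop_nhds_zero_nat (𝕜 := ℝ)).const_mul t
  have key : ∀ ε > 0, ENNReal.ofReal (1 - ε * t) * μ K ≤ μ (Φ t '' K) := by
    intro ε hε
    obtain ⟨δ, hδ, hvol⟩ := exists_le_measure_eulerStep_image μ hF hdiv (ρ + 1) hε
    -- The image is compact, so its measure is the limit of the measures of its closed
    -- neighbourhoods; it suffices to bound those from below.
    have hlim : Tendsto (fun n : ℕ => μ (cthickening (t / ((n : ℝ) + 1) * C) (Φ t '' K))) atTop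
        (𝓝 (μ (Φ t '' K))) :=
      (tendsto_measure_cthickening_of_isCompact himage).comp (by simpa using hstep_lim.mul_const C)
    refine ge_of_tendsto hlim ?_
    have e1 : ∀ᶠ n : ℕ in atTop, t / ((n : ℝ) + 1) < δ := hstep_lim.eventually (gt_mem_nhds hδ)
    have e2 : ∀ᶠ n : ℕ in atTop, t / ((n : ℝ) + 1) * C < 1 :=
      (by simpa using hstep_lim.mul_const C : Tendsto _ _ (𝓝 (0 : ℝ))).eventually
        (gt_mem_nhds one_pos)
    have e3 : ∀ᶠ n : ℕ in atTop, ε * (t / ((n : ℝ) + 1)) < 1 :=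
      (by simpa using hstep_lim.const_mul ε : Tendsto _ _ (𝓝 (0 : ℝ))).eventually
        (gt_mem_nhds one_pos)
    filter_upwards [e1, e2, e3] with n hn1 hn2 hn3
    set h := t / ((n : ℝ) + 1)
    have hh : 0 ≤ h := by positivity
    have hnh : ((n + 1 : ℕ) : ℝ) * h = t := by
      push_cast
      exact mul_div_cancel₀ t (by positivity)
    have hexp : ∀ k ≤ n + 1, h * |M| * ((1 + h * L) ^ k - 1) ≤ h * C := by
      intro k hk
      have h1 : (1 + h * L) ^ k ≤ Real.exp (L * t) := by
        calc (1 + h * (L : ℝ)) ^ k ≤ (1 + h * L) ^ (n + 1) :=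
              pow_le_pow_right₀ (by linarith [mul_nonneg hh L.coe_nonneg]) hk
          _ ≤ Real.exp (h * L) ^ (n + 1) := by
              gcongr
              linarith [Real.add_one_le_exp (h * (L : ℝ))]
          _ = Real.exp (L * t) := by
              rw [← Real.exp_nat_mul]
              congr 1
              rw [← mul_assoc, hnh, mul_comm]
      calc _ ≤ h * |M| * Real.exp (L * t) := by gcongr; linarith
        _ = h * C := by ring
    have herr : ∀ z ∈ K, ∀ k ≤ n + 1, ‖(eulerStep F h)^[k] z - Φ (k * h) z‖ ≤ h * C := by
      intro z hz k hk
      have := norm_eulerStep_iterate_sub_le (γ := fun s => Φ s z) (hΦ z) hh hL hM' (abs_nonneg M)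
        (n := n + 1) (fun s hs => hρ z (hKR hz) s (by rwa [hnh] at hs))
        ((hexp _ le_rfl).trans hn2.le) hk
      simp only [h0] at this
      exact this.trans (hexp k hk)
    have hmem : ∀ k < n + 1, ∀ z ∈ K, (eulerStep F h)^[k] z ∈ closedBall 0 (ρ + 1) := by
      intro k hk z hz
      have h1 : ‖Φ (k * h) z‖ ≤ ρ := hρ z (hKR hz) _ ⟨by positivity, by
        rw [← hnh]
        gcongr⟩
      rw [mem_closedBall_zero_iff]
      have h2 := norm_le_norm_add_norm_sub' ((eulerStep F h)^[k] z) (Φ (k * h) z)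
      linarith [herr z hz k hk.le]
    have hlow := le_measure_eulerStep_iterate_image μ hF.continuous
      (hvol h ⟨hh, hn1.le⟩) hK hmem
    calc ENNReal.ofReal (1 - ε * t) * μ K ≤ ENNReal.ofReal (1 - ε * h) ^ (n + 1) * μ K := by
          gcongr
          rw [← ENNReal.ofReal_pow (by linarith)]
          refine ENNReal.ofReal_le_ofReal ?_
          -- Bernoulli's inequality: the accumulated loss over `n + 1` steps is at most `ε * t`.
          have := one_add_mul_le_pow (a := -(ε * h)) (by linarith) (n + 1)
          calc 1 - ε * t = 1 + ((n + 1 : ℕ) : ℝ) * -(ε * h) := by rw [← hnh]; ring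
            _ ≤ _ := by simpa [sub_eq_add_neg] using this
      _ ≤ μ ((eulerStep F h)^[n + 1] '' K) := hlow
      _ ≤ μ (cthickening (h * C) (Φ t '' K)) := by
          refine measure_mono ?_
          rintro _ ⟨z, hz, rfl⟩
          refine mem_cthickening_of_dist_le _ (Φ t z) _ _ ⟨z, hz, rfl⟩ ?_
          rw [dist_eq_norm]
          have := herr z hz (n + 1) le_rfl
          rwa [hnh] at this
  have hlim : Tendsto (fun ε : ℝ => ENNReal.ofReal (1 - ε * t) * μ K) (𝓝[>] 0) (𝓝 (μ K)) := by
    have h1 : Tendsto (fun ε : ℝ => ENNReal.ofReal (1 - ε * t)) (𝓝 0) (𝓝 1) := by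
      have : Continuous fun ε : ℝ => ENNReal.ofReal (1 - ε * t) :=
        ENNReal.continuous_ofReal.comp (by fun_prop)
      simpa using this.tendsto 0
    have h2 := ENNReal.Tendsto.mul_const (b := μ K) (h1.mono_left (nhdsWithin_le_nhds (s := Ioi 0)))
      (Or.inl one_ne_zero)
    rwa [one_mul] at h2
  exact le_of_tendsto hlim (eventually_mem_nhdsWithin.mono key)

/-- **Liouville's theorem**: a flow of a divergence-free `C¹` field preserves volume. -/
theorem measurePreserving_flow {F : V → V} (hF : ContDiff ℝ 1 F)
    (hdiv : ∀ z, LinearMap.trace ℝ V (fderiv ℝ F z : V →ₗ[ℝ] V) = 0) {Φ : ℝ → V → V}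
    (h0 : ∀ z, Φ 0 z = z) (hΦ : ∀ z t, HasDerivAt (fun s => Φ s z) (F (Φ t z)) t)
    (hb : ∀ R t : ℝ, ∃ ρ : ℝ, ∀ z ∈ closedBall 0 R, ∀ s ∈ Icc (-t) t, ‖Φ s z‖ ≤ ρ) (t : ℝ) :
    MeasurePreserving (Φ t) μ μ := by
  have := FiniteDimensional.proper ℝ V
  have hFneg : ContDiff ℝ 1 fun z => -F z := hF.neg
  have hdivneg : ∀ z, LinearMap.trace ℝ V (fderiv ℝ (fun z => -F z) z : V →ₗ[ℝ] V) = 0 := by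
    intro z
    rw [fderiv_fun_neg, ContinuousLinearMap.toLinearMap_neg, map_neg, hdiv, neg_zero]
  have hΦneg : ∀ z t, HasDerivAt (fun s => Φ (-s) z) (-F (Φ (-t) z)) t := by
    intro z t
    have := (hΦ z (-t)).scomp t (hasDerivAt_neg t)
    rwa [neg_one_smul] at this
  have hcont : ∀ t, Continuous (Φ t) := by
    intro t
    refine continuous_iff_continuousAt.2 fun z => ?_
    obtain ⟨ρ, hρ⟩ := hb (‖z‖ + 1) |t|
    have hnhds : closedBall (0 : V) (‖z‖ + 1) ∈ 𝓝 z :=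
      mem_of_superset (ball_mem_nhds z one_pos) fun y hy => by
        rw [mem_closedBall_zero_iff]
        have := norm_le_norm_add_norm_sub' y z
        rw [mem_ball, dist_eq_norm] at hy
        linarith
    rcases le_total 0 t with ht | ht
    · exact (hF.continuousOn_flow h0 hΦ ht fun z hz s hs => hρ z hz s
        ⟨by linarith [abs_nonneg t, hs.1], hs.2.trans (le_abs_self t)⟩).continuousAt hnhds
    · have := (hFneg.continuousOn_flow (Φ := fun t => Φ (-t)) (t := -t) (by simpa using h0) hΦneg
        (by linarith) fun z hz s hs => hρ z hz (-s)
          ⟨by linarith [neg_le_abs t, hs.2], by linarith [abs_nonneg t, hs.1]⟩).continuousAt hnhds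
      simpa using this
  have hcompact : ∀ t, ∀ K : Set V, IsCompact K → μ K ≤ μ (Φ t '' K) := by
    intro t K hK
    obtain ⟨R, hR⟩ := hK.isBounded.subset_closedBall 0
    obtain ⟨ρ, hρ⟩ := hb R |t|
    rcases le_total 0 t with ht | ht
    · exact le_measure_flow_image μ hF hdiv h0 hΦ ht (fun z hz s hs => hρ z hz s
        ⟨by linarith [abs_nonneg t, hs.1], hs.2.trans (le_abs_self t)⟩) hK hR
    · have := le_measure_flow_image μ hFneg hdivneg (Φ := fun t => Φ (-t)) (t := -t)
        (by simpa using h0) hΦneg (by linarith) (fun z hz s hs => hρ z hz (-s)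
          ⟨by linarith [neg_le_abs t, hs.2], by linarith [abs_nonneg t, hs.1]⟩) hK hR
      simpa using this
  have hgroup : ∀ t z, Φ (-t) (Φ t z) = z := by
    intro t z
    have := hF.integralCurve_eq (hΦ (Φ t z)) (γ' := fun s => Φ (s + t) z)
      (fun s => (hΦ z (s + t)).comp_add_const s t) (by simp [h0])
    simpa [h0] using congrFun this (-t)
  -- By inner regularity it is enough to treat compact `K ⊆ A`, and `Φ (-t)` maps such `K` into `Φ t
  -- ⁻¹' A`.
  have hpre : ∀ t, ∀ A : Set V, MeasurableSet A → μ A ≤ μ (Φ t ⁻¹' A) := by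
    intro t A hA
    rw [hA.measure_eq_iSup_isCompact]
    refine iSup₂_le fun K hKA => iSup_le fun hK => (hcompact (-t) K hK).trans (measure_mono ?_)
    rintro _ ⟨z, hz, rfl⟩
    have := hgroup (-t) z
    rw [neg_neg] at this
    rw [mem_preimage, this]
    exact hKA hz
  refine ⟨(hcont t).measurable, Measure.ext fun A hA => ?_⟩
  rw [Measure.map_apply (hcont t).measurable hA]
  -- For the upper bound, `hpre (-t)` is applied to `Φ t ⁻¹' A`, whose preimage under `Φ (-t)` is
  -- `A`.
  refine le_antisymm ((hpre (-t) _ ((hcont t).measurable hA)).trans_eq ?_) (hpre t A hA)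
  rw [← preimage_comp]
  congr 1
  ext z
  have := hgroup (-t) z
  rw [neg_neg] at this
  rw [mem_preimage, Function.comp_apply, this]

end Liouville

/-! ### Adjoints and traces. -/

section Adjoint

variable {E₁ E₂ : Type*} [NormedAddCommGroup E₁] [InnerProductSpace ℝ E₁] [CompleteSpace E₁]
  [NormedAddCommGroup E₂] [InnerProductSpace ℝ E₂] [CompleteSpace E₂]

/-- The adjoint on a real Hilbert space, as a continuous linear map. -/
noncomputable def adjointCLM : (E₁ →L[ℝ] E₂) →L[ℝ] E₂ →L[ℝ] E₁ :=
  IsBoundedLinearMap.toContinuousLinearMap (f := fun A => ContinuousLinearMap.adjoint A)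
    ⟨⟨fun A B => map_add _ A B, fun c A => by simp⟩, 1, one_pos, fun A => by simp⟩

theorem trace_adjoint_eq [FiniteDimensional ℝ E₁] (A : E₁ →L[ℝ] E₁) :
    LinearMap.trace ℝ E₁ (ContinuousLinearMap.adjoint A : E₁ →ₗ[ℝ] E₁) =
      LinearMap.trace ℝ E₁ (A : E₁ →ₗ[ℝ] E₁) := by
  let b := stdOrthonormalBasis ℝ E₁
  rw [LinearMap.trace_eq_sum_inner _ b, LinearMap.trace_eq_sum_inner _ b]
  refine Finset.sum_congr rfl fun i _ => ?_
  rw [ContinuousLinearMap.coe_coe, ContinuousLinearMap.coe_coe,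
    ContinuousLinearMap.adjoint_inner_right, real_inner_comm]

end Adjoint

section Trace

variable {V W : Type*} [NormedAddCommGroup V] [NormedSpace ℝ V] [NormedAddCommGroup W]
  [NormedSpace ℝ W] [FiniteDimensional ℝ V] [FiniteDimensional ℝ W]

/-- The identity is `inl ∘ fst + inr ∘ snd`, and the trace is cyclic. -/
theorem trace_prod_eq (A : V × W →ₗ[ℝ] V × W) :
    LinearMap.trace ℝ (V × W) A =
      LinearMap.trace ℝ V (LinearMap.fst ℝ V W ∘ₗ A ∘ₗ LinearMap.inl ℝ V W) +
        LinearMap.trace ℝ W (LinearMap.snd ℝ V W ∘ₗ A ∘ₗ LinearMap.inr ℝ V W) := by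
  rw [← LinearMap.comp_assoc, ← LinearMap.comp_assoc,
    LinearMap.trace_comp_comm' (LinearMap.inl ℝ V W) (LinearMap.fst ℝ V W ∘ₗ A),
    LinearMap.trace_comp_comm' (LinearMap.inr ℝ V W) (LinearMap.snd ℝ V W ∘ₗ A), ← map_add]
  congr 1
  ext z <;> simp

/-- Operators with `Q ∘ P = 0` give `tr (P ∘ A ∘ Q) = 0`. -/
theorem trace_comp_comp_eq_zero {P Q : V →ₗ[ℝ] V} (h : Q ∘ₗ P = 0) (A : V →ₗ[ℝ] V) :
    LinearMap.trace ℝ V (P ∘ₗ A ∘ₗ Q) = 0 := by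
  rw [LinearMap.trace_comp_comm', LinearMap.comp_assoc, h, LinearMap.comp_zero, map_zero]

end Trace

/-! ### Algebra of the projections and of the field. -/

namespace Hug

variable {n m : ℕ} {f : E n → E m}

theorem range_J_eq_top {x : E n}
    (hx : Module.finrank ℝ (J f x : E n →ₗ[ℝ] E m).range = m) :
    (J f x : E n →ₗ[ℝ] E m).range = ⊤ :=
  Submodule.eq_top_of_finrank_eq (by simpa using hx)

/-- The kernel of `J Jᵀ` is that of `Jᵀ`, the orthogonal complement of the range of `J`, hence zero.
-/
theorem isUnit_J_comp_adjoint {x : E n}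
    (hx : Module.finrank ℝ (J f x : E n →ₗ[ℝ] E m).range = m) :
    IsUnit (J f x ∘L ContinuousLinearMap.adjoint (J f x)) := by
  have hker : (J f x ∘L ContinuousLinearMap.adjoint (J f x) : E m →ₗ[ℝ] E m).ker = ⊥ := by
    rw [ContinuousLinearMap.ker_self_comp_adjoint, ← ContinuousLinearMap.adjoint_toLinearMap,
      ← LinearMap.orthogonal_range, range_J_eq_top hx, Submodule.top_orthogonal_eq_bot]
  have hinj : Function.Injective (J f x ∘L ContinuousLinearMap.adjoint (J f x)) :=
    LinearMap.ker_eq_bot.1 hker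
  exact ContinuousLinearMap.isUnit_iff_bijective.2
    ⟨hinj, LinearMap.injective_iff_surjective.1 hinj⟩

theorem J_comp_Jplus {x : E n}
    (hx : Module.finrank ℝ (J f x : E n →ₗ[ℝ] E m).range = m) :
    J f x ∘L Jplus f x = ContinuousLinearMap.id ℝ (E m) := by
  rw [Jplus, ← ContinuousLinearMap.comp_assoc]
  exact Ring.mul_inverse_cancel _ (isUnit_J_comp_adjoint hx)

theorem J_comp_N {x : E n} (hx : Module.finrank ℝ (J f x : E n →ₗ[ℝ] E m).range = m) :
    J f x ∘L N f x = J f x := by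
  rw [N, ← ContinuousLinearMap.comp_assoc, J_comp_Jplus hx, ContinuousLinearMap.id_comp]

theorem N_comp_Jplus {x : E n} (hx : Module.finrank ℝ (J f x : E n →ₗ[ℝ] E m).range = m) :
    N f x ∘L Jplus f x = Jplus f x := by
  rw [N, ContinuousLinearMap.comp_assoc, J_comp_Jplus hx, ContinuousLinearMap.comp_id]

theorem N_comp_N {x : E n} (hx : Module.finrank ℝ (J f x : E n →ₗ[ℝ] E m).range = m) :
    N f x ∘L N f x = N f x := by
  conv_lhs => rw [N.eq_1 f x, ContinuousLinearMap.comp_assoc, ← N.eq_1 f x, J_comp_N hx]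
  rfl

theorem T_comp_T {x : E n} (hx : Module.finrank ℝ (J f x : E n →ₗ[ℝ] E m).range = m) :
    T f x ∘L T f x = T f x := by
  simp only [T, ContinuousLinearMap.comp_sub, ContinuousLinearMap.sub_comp, N_comp_N hx,
    ContinuousLinearMap.id_comp, ContinuousLinearMap.comp_id]
  abel

theorem N_comp_T {x : E n} (hx : Module.finrank ℝ (J f x : E n →ₗ[ℝ] E m).range = m) :
    N f x ∘L T f x = 0 := by
  rw [T, ContinuousLinearMap.comp_sub, N_comp_N hx, ContinuousLinearMap.comp_id, sub_self]

theorem T_comp_N {x : E n} (hx : Module.finrank ℝ (J f x : E n →ₗ[ℝ] E m).range = m) :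
    T f x ∘L N f x = 0 := by
  rw [T, ContinuousLinearMap.sub_comp, N_comp_N hx, ContinuousLinearMap.id_comp, sub_self]

theorem J_T_apply {x : E n} (hx : Module.finrank ℝ (J f x : E n →ₗ[ℝ] E m).range = m)
    (v : E n) : J f x (T f x v) = 0 := by
  have : J f x ∘L T f x = 0 := by
    rw [T, ContinuousLinearMap.comp_sub, J_comp_N hx, ContinuousLinearMap.comp_id, sub_self]
  exact congrArg (· v) this

theorem adjoint_N (f : E n → E m) (x : E n) : ContinuousLinearMap.adjoint (N f x) = N f x := by
  have h : ContinuousLinearMap.adjoint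
      (Ring.inverse (J f x ∘L ContinuousLinearMap.adjoint (J f x))) =
      Ring.inverse (J f x ∘L ContinuousLinearMap.adjoint (J f x)) := by
    rw [← ContinuousLinearMap.star_eq_adjoint, ← Ring.inverse_star,
      ContinuousLinearMap.star_eq_adjoint, ContinuousLinearMap.adjoint_comp,
      ContinuousLinearMap.adjoint_adjoint]
  simp only [N, Jplus, ContinuousLinearMap.adjoint_comp, ContinuousLinearMap.adjoint_adjoint, h,
    ContinuousLinearMap.comp_assoc]

theorem adjoint_T (f : E n → E m) (x : E n) : ContinuousLinearMap.adjoint (T f x) = T f x := by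
  rw [T, map_sub, adjoint_N, ContinuousLinearMap.adjoint_id]

theorem norm_T_apply_le {x : E n}
    (hx : Module.finrank ℝ (J f x : E n →ₗ[ℝ] E m).range = m) (v : E n) :
    ‖T f x v‖ ≤ ‖v‖ := by
  have h : ‖T f x v‖ * ‖T f x v‖ ≤ ‖T f x v‖ * ‖v‖ := by
    calc ‖T f x v‖ * ‖T f x v‖ = inner ℝ (T f x v) (T f x v) :=
          (real_inner_self_eq_norm_mul_norm _).symm
      _ = inner ℝ (T f x v) v := by
          conv_lhs => rw [← ContinuousLinearMap.adjoint_inner_left, adjoint_T,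
            ← ContinuousLinearMap.comp_apply, T_comp_T hx]
      _ ≤ _ := real_inner_le_norm _ _
  rcases (norm_nonneg (T f x v)).eq_or_lt with h0 | h0
  · rw [← h0]; exact norm_nonneg v
  · exact le_of_mul_le_mul_left h h0

/-- `N'_⊥(x)[w]` as a linear function of `w`. -/
noncomputable def NperpL (f : E n → E m) (x : E n) : E n →L[ℝ] E n →L[ℝ] E n :=
  ContinuousLinearMap.compL ℝ (E n) (E m) (E n) (Jplus f x) ∘L
    (ContinuousLinearMap.compL ℝ (E n) (E n) (E m)).flip (T f x) ∘L H f x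

/-- `N'_∥(x)[w] - N'_⊥(x)[w]` as a linear function of `w`. -/
noncomputable def skewL (f : E n → E m) (x : E n) : E n →L[ℝ] E n →L[ℝ] E n :=
  adjointCLM ∘L NperpL f x - NperpL f x

theorem skewL_apply (f : E n → E m) (x w : E n) : skewL f x w = Npar f x w - Nperp f x w := rfl

theorem field_eq (f : E n → E m) (z : E n × E n) :
    field f z = (T f z.1 z.2, skewL f z.1 ((T f z.1 - N f z.1) z.2) z.2) := rfl

theorem inner_field_snd (f : E n → E m) (z : E n × E n) : inner ℝ z.2 (field f z).2 = 0 := by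
  rw [field_eq]
  simp only [skewL_apply, Npar, sub_apply _ _ z.2, inner_sub_right]
  rw [ContinuousLinearMap.adjoint_inner_right, real_inner_comm, sub_self]

/-- The second component is quadratic in `v`, so the sign disappears there. -/
theorem field_neg (f : E n → E m) (x v : E n) :
    field f (x, -v) = (-(field f (x, v)).1, (field f (x, v)).2) := by
  simp only [field_eq, map_neg, neg_apply, neg_neg]

/-! ### Smoothness and divergence of the field. -/

section Smooth

variable (hf : ContDiff ℝ ∞ f)
  (hrank : ∀ x, Module.finrank ℝ (J f x : E n →ₗ[ℝ] E m).range = m)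
include hf

theorem contDiff_J : ContDiff ℝ ∞ (J f) := hf.fderiv_right (by simp)

theorem contDiff_H : ContDiff ℝ ∞ (H f) := (contDiff_J hf).fderiv_right (by simp)

include hrank

theorem contDiff_Jplus : ContDiff ℝ ∞ (Jplus f) := by
  have hA : ContDiff ℝ ∞ fun x => ContinuousLinearMap.adjoint (J f x) :=
    (adjointCLM (E₁ := E n) (E₂ := E m)).contDiff.comp (contDiff_J hf)
  refine hA.clm_comp (contDiff_iff_contDiffAt.2 fun x => ?_)
  obtain ⟨u, hu⟩ := isUnit_J_comp_adjoint (hrank x)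
  have h1 : ContDiffAt ℝ ∞ Ring.inverse (J f x ∘L ContinuousLinearMap.adjoint (J f x)) := by
    rw [← hu]
    exact contDiffAt_ringInverse ℝ u
  exact h1.comp x ((contDiff_J hf).clm_comp hA).contDiffAt

theorem contDiff_N : ContDiff ℝ ∞ (N f) := (contDiff_Jplus hf hrank).clm_comp (contDiff_J hf)

theorem contDiff_T : ContDiff ℝ ∞ (T f) := contDiff_const.sub (contDiff_N hf hrank)

theorem contDiff_NperpL : ContDiff ℝ ∞ (NperpL f) :=
  ((ContinuousLinearMap.contDiff _).comp (contDiff_Jplus hf hrank)).clm_comp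
    (((ContinuousLinearMap.contDiff _).comp (contDiff_T hf hrank)).clm_comp (contDiff_H hf))

theorem contDiff_skewL : ContDiff ℝ ∞ (skewL f) :=
  (contDiff_const.clm_comp (contDiff_NperpL hf hrank)).sub (contDiff_NperpL hf hrank)

theorem contDiff_field : ContDiff ℝ ∞ (field f) := by
  have hT : ContDiff ℝ ∞ fun z : E n × E n => T f z.1 := (contDiff_T hf hrank).comp contDiff_fst
  have hN : ContDiff ℝ ∞ fun z : E n × E n => N f z.1 := (contDiff_N hf hrank).comp contDiff_fst
  have hS : ContDiff ℝ ∞ fun z : E n × E n => skewL f z.1 :=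
    (contDiff_skewL hf hrank).comp contDiff_fst
  exact (hT.clm_apply contDiff_snd).prodMk
    ((hS.clm_apply ((hT.sub hN).clm_apply contDiff_snd)).clm_apply contDiff_snd)

/-- The derivative of the normal projection. -/
theorem fderiv_N_apply (x w : E n) : fderiv ℝ (N f) x w = Nperp f x w + Npar f x w := by
  have hN : HasFDerivAt (N f) (fderiv ℝ (N f) x) x :=
    ((contDiff_N hf hrank).differentiable (by simp) x).hasFDerivAt
  have hJ : HasFDerivAt (J f) (H f x) x :=
    ((contDiff_J hf).differentiable (by simp) x).hasFDerivAt
  -- Here `J N = J` is differentiated; `h2` and `h3` come in the same way from `N N = N` and `Nᵀ =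
  -- N`.
  have h1 : J f x ∘L fderiv ℝ (N f) x w + H f x w ∘L N f x = H f x w := by
    have h := hJ.clm_comp hN
    rw [show (fun y => J f y ∘L N f y) = J f from funext fun y => J_comp_N (hrank y)] at h
    exact congrArg (· w) (h.unique hJ)
  have h2 : N f x ∘L fderiv ℝ (N f) x w + fderiv ℝ (N f) x w ∘L N f x = fderiv ℝ (N f) x w := by
    have h := hN.clm_comp hN
    rw [show (fun y => N f y ∘L N f y) = N f from funext fun y => N_comp_N (hrank y)] at h
    exact congrArg (· w) (h.unique hN)
  have h3 : ContinuousLinearMap.adjoint (fderiv ℝ (N f) x w) = fderiv ℝ (N f) x w := by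
    have h := adjointCLM.hasFDerivAt.comp x hN
    rw [show adjointCLM ∘ N f = N f from funext fun y => adjoint_N f y] at h
    exact congrArg (· w) (h.unique hN)
  -- By `h1`, `J N'[w] = H[w] T`; composing with `J⁺` gives `N N'[w]`. The other half, `h5`, is its
  -- adjoint.
  have h4 : N f x ∘L fderiv ℝ (N f) x w = Nperp f x w := by
    have h : J f x ∘L fderiv ℝ (N f) x w = H f x w ∘L T f x := by
      rw [T, ContinuousLinearMap.comp_sub, ContinuousLinearMap.comp_id]
      exact eq_sub_of_add_eq h1
    rw [N, ContinuousLinearMap.comp_assoc, h, Nperp]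
  have h5 : fderiv ℝ (N f) x w ∘L N f x = Npar f x w := by
    rw [Npar, ← h4, ContinuousLinearMap.adjoint_comp, h3, adjoint_N]
  rw [← h4, ← h5, h2]

theorem hasFDerivAt_T (x : E n) :
    HasFDerivAt (T f) (-(NperpL f x + adjointCLM ∘L NperpL f x)) x := by
  have h : HasFDerivAt (T f) (0 - fderiv ℝ (N f) x) x := (hasFDerivAt_const _ x).sub
    ((contDiff_N hf hrank).differentiable (by simp) x).hasFDerivAt
  convert h using 1
  ext1 w
  change _ = 0 - fderiv ℝ (N f) x w
  rw [zero_sub, neg_apply, fderiv_N_apply hf hrank]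
  rfl

/-- Only the diagonal blocks of the derivative matter. The factor `T - N` in the field is what makes
their sum collapse to multiples of `P T` and `Q N`, both of trace zero. -/
theorem divergence_field (z : E n × E n) : divergence (field f) z = 0 := by
  obtain ⟨x, v⟩ := z
  have hF : HasFDerivAt (field f) (fderiv ℝ (field f) (x, v)) (x, v) :=
    ((contDiff_field hf hrank).differentiable (by simp) _).hasFDerivAt
  -- the two diagonal blocks of the derivative
  have hx : ContinuousLinearMap.fst ℝ (E n) (E n) ∘L fderiv ℝ (field f) (x, v) ∘L
      ContinuousLinearMap.inl ℝ (E n) (E n) =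
      (-(NperpL f x + adjointCLM ∘L NperpL f x)).flip v := by
    have h0 := HasFDerivAt.comp (g := field f) x hF (hasFDerivAt_prodMk_left (𝕜 := ℝ) x v)
    have h1 := HasFDerivAt.comp x (hasFDerivAt_fst (𝕜 := ℝ)) h0
    have h2 := (hasFDerivAt_T hf hrank x).clm_apply (hasFDerivAt_const v x)
    rw [ContinuousLinearMap.comp_zero, zero_add] at h2
    exact h1.unique h2
  have hv : ContinuousLinearMap.snd ℝ (E n) (E n) ∘L fderiv ℝ (field f) (x, v) ∘L
      ContinuousLinearMap.inr ℝ (E n) (E n) =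
      skewL f x ((T f x - N f x) v) + (skewL f x ∘L (T f x - N f x)).flip v := by
    have h0 := HasFDerivAt.comp (g := field f) v hF (hasFDerivAt_prodMk_right (𝕜 := ℝ) x v)
    have h1 := HasFDerivAt.comp v (hasFDerivAt_snd (𝕜 := ℝ)) h0
    have h2 := (skewL f x ∘L (T f x - N f x)).hasFDerivAt.clm_apply (hasFDerivAt_id v)
    exact h1.unique h2
  let P : E n →ₗ[ℝ] E n := ((NperpL f x).flip v).toLinearMap
  let Q : E n →ₗ[ℝ] E n := ((adjointCLM ∘L NperpL f x).flip v).toLinearMap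
  have hP : LinearMap.trace ℝ (E n) (P ∘ₗ (T f x : E n →ₗ[ℝ] E n)) = 0 := by
    -- `P` takes values in the range of `N`, so `tr (P T) = tr (N P T) = tr (P T N) = 0`.
    have h : P = (N f x : E n →ₗ[ℝ] E n) ∘ₗ P := by
      ext1 w
      change Nperp f x w v = (N f x ∘L Nperp f x w) v
      conv_lhs => rw [Nperp, ← N_comp_Jplus (hrank x)]
      rfl
    rw [h, LinearMap.comp_assoc]
    exact trace_comp_comp_eq_zero
      (congrArg (fun A : E n →L[ℝ] E n => (A : E n →ₗ[ℝ] E n)) (T_comp_N (hrank x))) P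
  have hQ : LinearMap.trace ℝ (E n) (Q ∘ₗ (N f x : E n →ₗ[ℝ] E n)) = 0 := by
    have h : Q = (T f x : E n →ₗ[ℝ] E n) ∘ₗ Q := by
      ext1 w
      change Npar f x w v = (T f x ∘L Npar f x w) v
      rw [Npar, Nperp, ContinuousLinearMap.adjoint_comp, ContinuousLinearMap.adjoint_comp,
        adjoint_T, ← ContinuousLinearMap.comp_assoc, ← ContinuousLinearMap.comp_assoc,
        T_comp_T (hrank x)]
    rw [h, LinearMap.comp_assoc]
    exact trace_comp_comp_eq_zero
      (congrArg (fun A : E n →L[ℝ] E n => (A : E n →ₗ[ℝ] E n)) (N_comp_T (hrank x))) Q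
  have hS : LinearMap.trace ℝ (E n)
      (skewL f x ((T f x - N f x) v) : E n →ₗ[ℝ] E n) = 0 := by
    rw [skewL_apply, ContinuousLinearMap.toLinearMap_sub, map_sub, Npar, trace_adjoint_eq,
      sub_self]
  -- Writing the identity as `T + N` in `-(P + Q)`, the terms `P N` and `Q T` cancel against `(Q -
  -- P)(T - N)`.
  have hsum : ((-(NperpL f x + adjointCLM ∘L NperpL f x)).flip v : E n →ₗ[ℝ] E n) +
      ((skewL f x ∘L (T f x - N f x)).flip v : E n →ₗ[ℝ] E n) =
      (-2 : ℝ) • (P ∘ₗ (T f x : E n →ₗ[ℝ] E n)) + (-2 : ℝ) • (Q ∘ₗ (N f x : E n →ₗ[ℝ] E n)) := by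
    have hPv : ∀ w, NperpL f x w v = P w := fun w => rfl
    have hQv : ∀ w, adjointCLM (NperpL f x w) v = Q w := fun w => rfl
    ext1 w
    have hTw : T f x w = w - N f x w := rfl
    simp only [LinearMap.add_apply, LinearMap.smul_apply, LinearMap.comp_apply,
      ContinuousLinearMap.coe_coe, ContinuousLinearMap.flip_apply, neg_apply,
      add_apply, sub_apply,
      ContinuousLinearMap.comp_apply, skewL, hPv, hQv, hTw, map_sub]
    module
  rw [divergence, trace_prod_eq]
  change LinearMap.trace ℝ (E n) ((ContinuousLinearMap.fst ℝ (E n) (E n) ∘L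
      fderiv ℝ (field f) (x, v) ∘L ContinuousLinearMap.inl ℝ (E n) (E n) :
        E n →L[ℝ] E n) : E n →ₗ[ℝ] E n) +
    LinearMap.trace ℝ (E n) ((ContinuousLinearMap.snd ℝ (E n) (E n) ∘L
      fderiv ℝ (field f) (x, v) ∘L ContinuousLinearMap.inr ℝ (E n) (E n) :
        E n →L[ℝ] E n) : E n →ₗ[ℝ] E n) = 0
  rw [hx, hv, ContinuousLinearMap.toLinearMap_add, map_add, hS, zero_add, ← map_add, hsum, map_add,
    map_smul, map_smul, hP, hQ, smul_zero, add_zero]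

end Smooth

end Hug

/-! ### Conserved quantities, reversibility and the global flow. -/

theorem Set.OrdConnected.eq_of_hasDerivWithinAt_zero {V : Type*} [NormedAddCommGroup V]
    [NormedSpace ℝ V] {I : Set ℝ} (hI : I.OrdConnected) {g : ℝ → V}
    (hg : ∀ t ∈ I, HasDerivWithinAt g 0 I t) {s t : ℝ} (hs : s ∈ I) (ht : t ∈ I) : g t = g s := by
  have := hI.convex.norm_image_sub_le_of_norm_hasDerivWithin_le (C := 0) hg (by simp) hs ht
  rw [zero_mul] at this
  exact sub_eq_zero.1 (norm_le_zero_iff.1 this)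

namespace Hug

variable {n m : ℕ} {f : E n → E m}

/-- The factor `c` covers both true solutions (`c = 1`) and curves of the cut-off field used for
global existence. -/
theorem hasDerivWithinAt_norm_sq {I : Set ℝ} {x v : ℝ → E n} {c t : ℝ}
    (hv : HasDerivWithinAt v (c • (field f (x t, v t)).2) I t) :
    HasDerivWithinAt (fun s => ‖v s‖ ^ 2) 0 I t := by
  have := hv.norm_sq
  have h0 := inner_field_snd f (x t, v t)
  rwa [inner_smul_right, h0, mul_zero, mul_zero] at this

theorem norm_eq_of_hasDerivWithinAt {I : Set ℝ} (hI : I.OrdConnected) {x v : ℝ → E n} {c : ℝ → ℝ}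
    (hv : ∀ t ∈ I, HasDerivWithinAt v (c t • (field f (x t, v t)).2) I t) {s t : ℝ}
    (hs : s ∈ I) (ht : t ∈ I) : ‖v t‖ = ‖v s‖ :=
  (sq_eq_sq₀ (norm_nonneg _) (norm_nonneg _)).1 <|
    hI.eq_of_hasDerivWithinAt_zero (fun r hr => hasDerivWithinAt_norm_sq (hv r hr)) hs ht

theorem hasDerivWithinAt_comp_eq_zero (hf : Differentiable ℝ f) {I : Set ℝ} {x v : ℝ → E n} {t : ℝ}
    (hrank : Module.finrank ℝ (J f (x t) : E n →ₗ[ℝ] E m).range = m)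
    (hx : HasDerivWithinAt x (field f (x t, v t)).1 I t) :
    HasDerivWithinAt (fun s => f (x s)) 0 I t := by
  have := (hf (x t)).hasFDerivAt.comp_hasDerivWithinAt t hx
  rwa [show fderiv ℝ f (x t) (field f (x t, v t)).1 = 0 from J_T_apply hrank (v t)] at this

theorem IsSolutionOn.reverse {I : Set ℝ} {x v : ℝ → E n} (h : IsSolutionOn f I x v) :
    IsSolutionOn f {t | -t ∈ I} (fun t => x (-t)) (fun t => -v (-t)) := by
  intro t ht
  obtain ⟨h1, h2⟩ := h (-t) ht
  have hneg : HasDerivWithinAt (fun t : ℝ => -t) (-1) {t | -t ∈ I} t :=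
    (hasDerivAt_neg t).hasDerivWithinAt
  have h1' := h1.scomp t hneg fun s hs => hs
  have h2' := (h2.scomp t hneg fun s hs => hs).fun_neg
  rw [neg_one_smul] at h1' h2'
  rw [neg_neg] at h2'
  rw [field_neg]
  exact ⟨h1', h2'⟩

theorem isSolutionOn_reverse_iff {I : Set ℝ} {x v : ℝ → E n} :
    IsSolutionOn f I x v ↔
      IsSolutionOn f {t | -t ∈ I} (fun t => x (-t)) (fun t => -v (-t)) :=
  ⟨fun h => h.reverse, fun h => by simpa using h.reverse⟩

/-- An integral curve of the system, possibly slowed down by a factor `χ ∈ [0, 1]`, moves away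
from its starting point at most linearly in time. -/
theorem norm_integralCurve_le
    (hrank : ∀ x, Module.finrank ℝ (J f x : E n →ₗ[ℝ] E m).range = m) {χ : E n × E n → ℝ}
    (hχ : ∀ z, χ z ∈ Icc (0 : ℝ) 1) {γ : ℝ → E n × E n} {a t : ℝ}
    (hγ : ∀ t ∈ Ioo (-a) a, HasDerivAt γ (χ (γ t) • field f (γ t)) t) (ht : t ∈ Ioo (-a) a) :
    ‖γ t‖ ≤ ‖γ 0‖ * (1 + a) := by
  have ha : 0 < a := by linarith [ht.1, ht.2]
  have h0 : (0 : ℝ) ∈ Ioo (-a) a := ⟨by linarith, ha⟩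
  have hx : ∀ t ∈ Ioo (-a) a, HasDerivWithinAt (fun t => (γ t).1)
      (χ (γ t) • T f (γ t).1 (γ t).2) (Ioo (-a) a) t := fun t ht =>
    ((ContinuousLinearMap.fst ℝ (E n) (E n)).hasFDerivAt.comp_hasDerivAt t (hγ t ht)).hasDerivWithinAt
  have hv : ∀ t ∈ Ioo (-a) a, HasDerivWithinAt (fun t => (γ t).2)
      (χ (γ t) • (field f ((γ t).1, (γ t).2)).2) (Ioo (-a) a) t := fun t ht =>
    ((ContinuousLinearMap.snd ℝ (E n) (E n)).hasFDerivAt.comp_hasDerivAt t (hγ t ht)).hasDerivWithinAt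
  have hvn : ∀ t ∈ Ioo (-a) a, ‖(γ t).2‖ = ‖(γ 0).2‖ := fun t ht =>
    norm_eq_of_hasDerivWithinAt (x := fun t => (γ t).1) (v := fun t => (γ t).2)
      (c := fun t => χ (γ t)) ordConnected_Ioo hv h0 ht
  -- Mean value inequality: the speed of `x` is at most `χ ‖T v‖ ≤ ‖v‖`, which is constant in time.
  have hxn : ‖(γ t).1 - (γ 0).1‖ ≤ ‖(γ 0).2‖ * ‖t - 0‖ := by
    refine (convex_Ioo (-a) a).norm_image_sub_le_of_norm_hasDerivWithin_le hx
      (fun s hs => ?_) h0 ht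
    rw [norm_smul, Real.norm_of_nonneg (hχ _).1, ← hvn s hs]
    calc χ (γ s) * ‖T f (γ s).1 (γ s).2‖ ≤ 1 * ‖(γ s).2‖ :=
          mul_le_mul (hχ _).2 (norm_T_apply_le (hrank _) _) (norm_nonneg _) zero_le_one
      _ = _ := one_mul _
  have h1 : ‖(γ 0).1‖ ≤ ‖γ 0‖ := norm_fst_le _
  have h2 : ‖(γ 0).2‖ ≤ ‖γ 0‖ := norm_snd_le _
  have hta : ‖t - 0‖ ≤ a := by
    rw [sub_zero]
    exact (abs_lt.2 ht).le
  refine norm_prod_le_iff.2 ⟨?_, ?_⟩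
  · calc ‖(γ t).1‖ ≤ ‖(γ 0).1‖ + ‖(γ t).1 - (γ 0).1‖ := norm_le_norm_add_norm_sub' _ _
      _ ≤ ‖γ 0‖ + ‖γ 0‖ * a := by
          refine add_le_add h1 (hxn.trans ?_)
          gcongr
      _ = _ := by ring
  · rw [hvn t ht]
    nlinarith [norm_nonneg (γ 0)]

theorem exists_isFlow (hf : ContDiff ℝ ∞ f)
    (hrank : ∀ x, Module.finrank ℝ (J f x : E n →ₗ[ℝ] E m).range = m) : ∃ Φ, IsFlow f Φ := by
  have hF : ContDiff ℝ 1 (field f) := (contDiff_field hf hrank).of_le (by simp)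
  have key : ∀ z, ∃ γ : ℝ → E n × E n, γ 0 = z ∧ ∀ t, HasDerivAt γ (field f (γ t)) t := fun z =>
    hF.exists_integralCurve_of_bound z fun a => ⟨‖z‖ * (1 + a), fun χ γ hχ h0 hγ t ht =>
      h0 ▸ norm_integralCurve_le hrank hχ hγ ht⟩
  choose γ h0 hγ using key
  refine ⟨fun t z => γ z t, fun z => ⟨h0 z, fun t _ => ⟨?_, ?_⟩⟩⟩
  · exact (hasFDerivAt_fst.comp_hasDerivAt t (hγ z t)).hasDerivWithinAt
  · exact (hasFDerivAt_snd.comp_hasDerivAt t (hγ z t)).hasDerivWithinAt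

theorem IsFlow.measurePreserving {Φ : ℝ → E n × E n → E n × E n} (hΦ : IsFlow f Φ)
    (hf : ContDiff ℝ ∞ f)
    (hrank : ∀ x, Module.finrank ℝ (J f x : E n →ₗ[ℝ] E m).range = m) (t : ℝ) :
    MeasurePreserving (Φ t) volume volume := by
  have hd : ∀ z t, HasDerivAt (fun s => Φ s z) (field f (Φ t z)) t := by
    intro z t
    have := (hΦ z).2 t (mem_univ t)
    rw [hasDerivWithinAt_univ, hasDerivWithinAt_univ] at this
    exact this.1.prodMk this.2
  have : (volume : Measure (E n × E n)).IsAddHaarMeasure :=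
    inferInstanceAs ((volume : Measure (E n)).prod volume).IsAddHaarMeasure
  refine measurePreserving_flow volume ((contDiff_field hf hrank).of_le (by simp))
    (divergence_field hf hrank) (fun z => (hΦ z).1) hd
    (fun R t => ⟨R * (1 + (|t| + 1)), fun z hz s hs => ?_⟩) t
  -- With `χ = 1`; the radius `|t| + 1` puts the closed interval `[-t, t]` inside an open one.
  refine (norm_integralCurve_le (χ := fun _ => 1) (γ := fun s => Φ s z) (a := |t| + 1) hrank
    (by simp) (fun r _ => by simpa using hd z r) (abs_lt.1 ?_)).trans ?_
  · exact ((abs_le.2 hs).trans (le_abs_self t)).trans_lt (lt_add_one _)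
  · rw [(hΦ z).1]
    gcongr
    exact mem_closedBall_zero_iff.1 hz

end Hug

theorem mainTheorem4 (n m : ℕ) (hm : 0 < m) (hmn : m < n)
    (f : Hug.E n → Hug.E m) (hf : ContDiff ℝ ∞ f)
    (hrank : ∀ x, Module.finrank ℝ (Hug.J f x : Hug.E n →ₗ[ℝ] Hug.E m).range = m) :
    -- 1. volume preservation: the field is divergence free, and there is a flow, which preserves
    -- Lebesgue measure
    ((∀ z, DifferentiableAt ℝ (Hug.field f) z ∧ Hug.divergence (Hug.field f) z = 0) ∧
      (∃ Φ, Hug.IsFlow f Φ) ∧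
      ∀ Φ, Hug.IsFlow f Φ → ∀ t, MeasureTheory.MeasurePreserving (Φ t)
        MeasureTheory.volume MeasureTheory.volume) ∧
    -- 2. time reversibility
    (∀ (I : Set ℝ) (x v : ℝ → Hug.E n), I.OrdConnected →
      (Hug.IsSolutionOn f I x v ↔
        Hug.IsSolutionOn f {t | -t ∈ I} (fun t => x (-t)) (fun t => -v (-t)))) ∧
    -- 3. conservation of the Euclidean length of `v`
    (∀ (I : Set ℝ) (x v : ℝ → Hug.E n), I.OrdConnected → Hug.IsSolutionOn f I x v →
      (∀ t ∈ I, HasDerivWithinAt (fun s => ‖v s‖ ^ 2) 0 I t) ∧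
      ∀ s ∈ I, ∀ t ∈ I, ‖v t‖ = ‖v s‖) ∧
    -- 4. `x` remains on a level set of `f`
    (∀ (I : Set ℝ) (x v : ℝ → Hug.E n), I.OrdConnected → Hug.IsSolutionOn f I x v →
      (∀ t ∈ I, HasDerivWithinAt (fun s => f (x s)) 0 I t) ∧
      ∀ s ∈ I, ∀ t ∈ I, x t ∈ Hug.levelSet f (f (x s))) := by
  refine ⟨⟨fun z => ⟨(Hug.contDiff_field hf hrank).differentiable (by simp) z,
      Hug.divergence_field hf hrank z⟩, Hug.exists_isFlow hf hrank,
      fun Φ hΦ t => hΦ.measurePreserving hf hrank t⟩,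
    fun I x v _ => Hug.isSolutionOn_reverse_iff, fun I x v hI h => ?_, fun I x v hI h => ?_⟩
  · have hv : ∀ t ∈ I, HasDerivWithinAt v ((1 : ℝ) • (Hug.field f (x t, v t)).2) I t := by
      simpa using fun t ht => (h t ht).2
    exact ⟨fun t ht => Hug.hasDerivWithinAt_norm_sq (hv t ht), fun s hs t ht =>
      Hug.norm_eq_of_hasDerivWithinAt (c := fun _ => 1) hI hv hs ht⟩
  · have hd : ∀ t ∈ I, HasDerivWithinAt (fun s => f (x s)) 0 I t := fun t ht =>
      Hug.hasDerivWithinAt_comp_eq_zero (hf.differentiable (by simp)) (hrank _) (h t ht).1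
    exact ⟨hd, fun s hs t ht => hI.eq_of_hasDerivWithinAt_zero hd hs ht⟩
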